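/- All matroids are on finite ground sets. The Tutte polynomial of a matroid $M$ on $E$ with rank function $\operatorname{rk}$ is $T_M(x,y)=\sum_{A\subseteq E}(x-1)^{\operatorname{rk}(E)-\operatorname{rk}(A)}(y-1)^{|A|-\operatorname{rk}(A)}\in\mathbb{Z}[x,y]$. A matroid is uniform if every subset of its ground set of cardinality equal to the rank is a basis. Let $M$ be a matroid of rank $k$ on $E$. A subset $A\subseteq E$ is stressed if the restriction $M|_A$ and the contraction $M/A$ are both uniform; its cusp is the family of $k$-subsets $S\subseteq E$ with $|S\cap A|\ge \operatorname{rk}(A)+1$; relaxing a stressed subset means adding its cusp to the bases. The matroid $M$ is elementary split if relaxing all its stressed subsets with non-empty cusp yields a uniform matroid, i.e. if every $k$-subset of $E$ is a basis of $M$ or lies in the cusp of a stressed subset of $M$. It is a Schubert (or nested) matroid if its cyclic flats (flats that are unions of circuits, the empty union being allowed) form a chain under inclusion. It is cuspidal if it is both elementary split and Schubert. Theorem. Let $0\le k\le n$ be integers. Up to isomorphism there are exactly $k(n-k)+1$ cuspidal matroids of rank $k$ on $n$ elements. Let $\Lambda_0,\dots,\Lambda_{k(n-k)}$ be representatives of their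 isomorphism classes. Then for every matroid $M$ of rank $k$ on $n$ elements there are unique integers $c_0,\dots,c_{k(n-k)}$ such that \[ T_M(x,y)=\sum_{i=0}^{k(n-k)} c_i\, T_{\Lambda_i}(x,y). \] -/

import Mathlib

namespace Matroid

/-- The Tutte polynomial `T_M(x, y) = ∑_{A ⊆ E} (x - 1)^(rk E - rk A) (y - 1)^(|A| - rk A)` of a
matroid on a finite ground set, with `x = X 0` and `y = X 1`. -/
noncomputable def tutte {α : Type*} (M : Matroid α) [M.Finite] : MvPolynomial (Fin 2) ℤ :=
  ∑ A ∈ M.ground_finite.toFinset.powerset,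
    (MvPolynomial.X 0 - 1) ^ (M.eRank.toNat - (M.eRk (A : Set α)).toNat) *
      (MvPolynomial.X 1 - 1) ^ (A.card - (M.eRk (A : Set α)).toNat)

/-- `M` is uniform: all subsets of the ground set of cardinality `rk M` are bases. -/
def IsUniform {α : Type*} (M : Matroid α) : Prop :=
  ∀ B ⊆ M.E, B.encard = M.eRank → M.IsBase B

/-- `A` is stressed in `M`: the restriction to `A` and the contraction of `A` are both uniform. -/
def IsStressed {α : Type*} (M : Matroid α) (A : Set α) : Prop :=
  A ⊆ M.E ∧ (M ↾ A).IsUniform ∧ (M ／ A).IsUniform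

/-- The cusp of `A`: the sets `S ⊆ E` with `|S| = rk M` and `|S ∩ A| ≥ rk A + 1`. -/
def cusp {α : Type*} (M : Matroid α) (A : Set α) : Set (Set α) :=
  {S | S ⊆ M.E ∧ S.encard = M.eRank ∧ M.eRk A + 1 ≤ (S ∩ A).encard}

/-- The bases of the matroid obtained from `M` by relaxing all stressed subsets with non-empty
cusp: relaxing `A` adds the members of the cusp of `A` to the bases. -/
def relaxedBases {α : Type*} (M : Matroid α) : Set (Set α) :=
  {B | M.IsBase B} ∪ ⋃ A ∈ {A | M.IsStressed A ∧ (M.cusp A).Nonempty}, M.cusp A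

/-- `M` is elementary split: relaxing all stressed subsets with non-empty cusp yields a uniform
matroid, i.e. the uniform matroid on the same ground set and of the same rank. -/
def IsElementarySplit {α : Type*} (M : Matroid α) : Prop :=
  M.relaxedBases = {S | S ⊆ M.E ∧ S.encard = M.eRank}

/-- A cyclic flat: a flat that is a (possibly empty) union of circuits. -/
def IsCyclicFlat {α : Type*} (M : Matroid α) (F : Set α) : Prop :=
  M.IsFlat F ∧ ∃ 𝒞 : Set (Set α), (∀ C ∈ 𝒞, M.IsCircuit C) ∧ F = ⋃₀ 𝒞

/-- `M` is a Schubert (nested) matroid: its cyclic flats form a chain. -/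
def IsSchubert {α : Type*} (M : Matroid α) : Prop :=
  IsChain (· ⊆ ·) {F | M.IsCyclicFlat F}

/-- `M` is cuspidal: it is both Schubert and elementary split. -/
def IsCuspidal {α : Type*} (M : Matroid α) : Prop :=
  M.IsSchubert ∧ M.IsElementarySplit

/-- The Tutte polynomial is an isomorphism invariant. -/
theorem tutte_mapEquiv {α β : Type*} (M : Matroid α) [M.Finite] (e : α ≃ β)
    [(M.mapEquiv e).Finite] : (M.mapEquiv e).tutte = M.tutte := by
  classical
  have hrk : ∀ A ⊆ M.E, (M.mapEquiv e).eRk (e '' A) = M.eRk A := by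
    intro A hA
    have h := eRk_map M (f := e) e.injective.injOn hA
    rwa [mapEquiv_eq_map]
  have hrank : (M.mapEquiv e).eRank = M.eRank := by
    have h := hrk M.E subset_rfl
    rw [eRk_ground] at h
    rw [← h, eRank_def, mapEquiv_ground_eq]
  unfold tutte
  symm
  refine Finset.sum_bij' (fun A _ => A.map e.toEmbedding) (fun A _ => A.map e.symm.toEmbedding)
    ?_ ?_ ?_ ?_ ?_
  · intro A hA
    simp only [Finset.mem_powerset, ← Finset.coe_subset, Set.Finite.coe_toFinset] at hA ⊢
    simpa using hA
  · intro A hA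
    simp only [Finset.mem_powerset, ← Finset.coe_subset, Set.Finite.coe_toFinset] at hA ⊢
    simpa [Equiv.symm_image_subset] using hA
  · intro A _
    simp [Finset.map_map]
  · intro A _
    simp [Finset.map_map]
  · intro A hA
    simp only [Finset.mem_powerset, ← Finset.coe_subset, Set.Finite.coe_toFinset] at hA
    simp [hrank, hrk _ hA]

/-- The cuspidal matroids of rank `k` on the ground set `Fin n`. -/
def CuspidalOn (n k : ℕ) : Type :=
  {M : Matroid (Fin n) // M.E = Set.univ ∧ M.eRank = k ∧ M.IsCuspidal}

/-- Isomorphism of cuspidal matroids on `Fin n`: one is obtained from the other by relabelling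
the elements. -/
instance cuspidalSetoid (n k : ℕ) : Setoid (CuspidalOn n k) where
  r M N := ∃ e : Fin n ≃ Fin n, M.1.mapEquiv e = N.1
  iseqv := by
    refine ⟨fun M => ⟨Equiv.refl _, ?_⟩, ?_, ?_⟩
    · ext <;> simp
    · rintro M N ⟨e, he⟩
      refine ⟨e.symm, ?_⟩
      rw [← he]
      ext <;> simp
    · rintro M N P ⟨e, he⟩ ⟨f, hf⟩
      refine ⟨e.trans f, ?_⟩
      rw [← hf, ← he]
      ext <;> simp [Set.image_image]

/-- The isomorphism classes of cuspidal matroids of rank `k` on `n` elements. -/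
def CuspidalClass (n k : ℕ) : Type := Quotient (cuspidalSetoid n k)

/-- The Tutte polynomial of an isomorphism class of cuspidal matroids. -/
noncomputable def CuspidalClass.tutte {n k : ℕ} (q : CuspidalClass n k) :
    MvPolynomial (Fin 2) ℤ :=
  Quotient.lift (fun M : CuspidalOn n k => M.1.tutte) (by
    rintro M N ⟨e, he⟩
    have h := tutte_mapEquiv M.1 e
    simp only [he] at h
    exact h.symm) q

end Matroid

/-! Put `u = x - 1`, `v = y - 1`. A set `A` contributes `u^p v^q` with `p = k - rk A` and `q = |A| -
rk A`. Since `p - q = k - |A|`, dividing by the largest power of `uv` leaves a monomial that depends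
on `|A|` only, and these monomials sum to the uniform Tutte polynomial `U`. Hence `T_M` is `U` plus
excesses with `p ≤ k`, `q ≤ n - k` (`tutte_eq_uniformTutte_add`); an excess vanishes if `p = 0` or
`q = 0`, so `k(n-k)` of them matter.

A nonuniform cuspidal matroid has exactly one stressed subset `A` with non-empty cusp, so it is
determined up to isomorphism by `s = k - rk A` and `t = |A| - rk A`
(`IsCuspidal.eq_cuspidalMatroid`). Its Tutte polynomial is `U`, plus the excess at `(s, t)` with
coefficient one, plus excesses at smaller pairs (`cuspidalMatroid_tutte_sub_mem`). This
unitriangularity makes the cuspidal Tutte polynomials a `ℤ`-basis of the span of `U` and the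
excesses, and shows that the `k(n-k) + 1` candidates are pairwise nonisomorphic. -/

namespace Matroid

open MvPolynomial

/-! ### Shifted monomials, excesses and their coefficients. -/

/-- The polynomial `(x - 1) ^ p * (y - 1) ^ q`. -/
noncomputable def tutteMonomial (p q : ℕ) : MvPolynomial (Fin 2) ℤ :=
  (X 0 - 1) ^ p * (X 1 - 1) ^ q

/-- The difference of `(x - 1) ^ p * (y - 1) ^ q` and its quotient by the largest possible power
of `(x - 1) * (y - 1)`. -/
noncomputable def tutteExcess (p q : ℕ) : MvPolynomial (Fin 2) ℤ :=
  tutteMonomial p q - tutteMonomial (p - q) (q - p)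

/-- The Tutte polynomial of the uniform matroid of rank `k` on `n` elements. -/
noncomputable def uniformTutte (n k : ℕ) : MvPolynomial (Fin 2) ℤ :=
  ∑ s ∈ Finset.range (n + 1), n.choose s • tutteMonomial (k - s) (s - k)

@[simp] theorem tutteExcess_zero_left (q : ℕ) : tutteExcess 0 q = 0 := by
  simp [tutteExcess]

@[simp] theorem tutteExcess_zero_right (p : ℕ) : tutteExcess p 0 = 0 := by
  simp [tutteExcess]

/-- The coefficient of `(x - 1) ^ p * (y - 1) ^ q`. -/
noncomputable def shiftedCoeff (p q : ℕ) : MvPolynomial (Fin 2) ℤ →ₗ[ℤ] ℤ :=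
  lcoeff ℤ (Finsupp.single 0 p + Finsupp.single 1 q) ∘ₗ
    (aeval fun i => (X i + 1 : MvPolynomial (Fin 2) ℤ)).toLinearMap

theorem shiftedCoeff_tutteMonomial (p q a b : ℕ) :
    shiftedCoeff p q (tutteMonomial a b) = if a = p ∧ b = q then 1 else 0 := by
  have h : (X 0 : MvPolynomial (Fin 2) ℤ) ^ a * X 1 ^ b
      = monomial (Finsupp.single 0 a + Finsupp.single 1 b) 1 := by
    simp [X_pow_eq_monomial, monomial_mul]
  have h2 : (Finsupp.single (0 : Fin 2) a + Finsupp.single 1 b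
      = Finsupp.single 0 p + Finsupp.single 1 q) ↔ (a = p ∧ b = q) := by
    constructor
    · intro h
      have h0 := DFunLike.congr_fun h 0
      have h1 := DFunLike.congr_fun h 1
      simp at h0 h1
      exact ⟨h0, h1⟩
    · rintro ⟨rfl, rfl⟩
      rfl
  simp [shiftedCoeff, tutteMonomial, h, coeff_monomial, h2]

/-- One of `a - b`, `b - a` is zero. So coefficients with both exponents positive see neither `U`
nor the subtracted part of an excess. -/
theorem shiftedCoeff_tutteMonomial_sub {p q : ℕ} (hp : 0 < p) (hq : 0 < q) (a b : ℕ) :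
    shiftedCoeff p q (tutteMonomial (a - b) (b - a)) = 0 := by
  rw [shiftedCoeff_tutteMonomial, if_neg (by omega)]

theorem shiftedCoeff_tutteExcess {p q : ℕ} (hp : 0 < p) (hq : 0 < q) (a b : ℕ) :
    shiftedCoeff p q (tutteExcess a b) = if a = p ∧ b = q then 1 else 0 := by
  rw [tutteExcess, map_sub, shiftedCoeff_tutteMonomial_sub hp hq, shiftedCoeff_tutteMonomial,
    sub_zero]

theorem shiftedCoeff_uniformTutte {p q : ℕ} (hp : 0 < p) (hq : 0 < q) (n k : ℕ) :
    shiftedCoeff p q (uniformTutte n k) = 0 := by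
  rw [uniformTutte, map_sum]
  refine Finset.sum_eq_zero fun s _ => ?_
  rw [map_nsmul, shiftedCoeff_tutteMonomial_sub hp hq, smul_zero]

theorem uniformTutte_ne_zero (n k : ℕ) : uniformTutte n k ≠ 0 := by
  intro h
  -- At `x = y = 2` every shifted monomial is `1`, so the value is `2 ^ n`.
  have h1 := congrArg (aeval fun _ => (2 : ℤ)) h
  simp only [uniformTutte, tutteMonomial, map_sum, map_nsmul, map_mul, map_pow, map_sub, aeval_X,
    map_one, map_zero] at h1
  norm_num at h1
  have h2 : (∑ s ∈ Finset.range (n + 1), n.choose s) = 0 := by exact_mod_cast h1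
  rw [Nat.sum_range_choose] at h2
  simp at h2

/-! ### Unitriangular families of excesses. -/

section Triangular

variable {n k m : ℕ} {T : Option (Fin k × Fin m) → MvPolynomial (Fin 2) ℤ}

/-- The span of the excesses that precede `tutteExcess s t` in the product order. -/
noncomputable def excessSpanBelow (s t : ℕ) : Submodule ℤ (MvPolynomial (Fin 2) ℤ) :=
  Submodule.span ℤ {f | ∃ p q, p ≤ s ∧ q ≤ t ∧ p + q < s + t ∧ f = tutteExcess p q}

/-- The triangular system is inverted by induction on `p + q`; the leading coefficients are `1`, so
no denominators arise. -/
theorem tutteExcess_mem_span_range (h0 : T none = uniformTutte n k)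
    (hT : ∀ (i : Fin k) (j : Fin m), T (some (i, j)) - uniformTutte n k - tutteExcess (i + 1) (j + 1)
      ∈ excessSpanBelow (i + 1) (j + 1)) {p q : ℕ} (hp : p ≤ k) (hq : q ≤ m) :
    tutteExcess p q ∈ Submodule.span ℤ (Set.range T) := by
  induction hd : p + q using Nat.strong_induction_on generalizing p q with
  | _ d ih =>
  obtain _ | i := p
  · simp
  obtain _ | j := q
  · simp
  have h1 : excessSpanBelow (i + 1) (j + 1) ≤ Submodule.span ℤ (Set.range T) := by
    refine Submodule.span_le.2 ?_
    rintro _ ⟨p, q, hp', hq', hlt, rfl⟩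
    exact ih (p + q) (by omega) (by omega) (by omega) rfl
  have h2 := h1 (hT ⟨i, hp⟩ ⟨j, hq⟩)
  have h3 : uniformTutte n k ∈ Submodule.span ℤ (Set.range T) :=
    h0 ▸ Submodule.subset_span ⟨none, rfl⟩
  have h4 : T (some (⟨i, hp⟩, ⟨j, hq⟩)) ∈ Submodule.span ℤ (Set.range T) :=
    Submodule.subset_span ⟨_, rfl⟩
  have h5 := sub_mem (sub_mem h4 h3) h2
  simpa using h5

theorem shiftedCoeff_eq_zero_of_mem_excessSpanBelow {s t p q : ℕ} (hp : 0 < p) (hq : 0 < q)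
    (h : s + t ≤ p + q) {f : MvPolynomial (Fin 2) ℤ} (hf : f ∈ excessSpanBelow s t) :
    shiftedCoeff p q f = 0 := by
  have hle : excessSpanBelow s t ≤ LinearMap.ker (shiftedCoeff p q) := by
    refine Submodule.span_le.2 ?_
    rintro _ ⟨a, b, ha, hb, hlt, rfl⟩
    simp only [SetLike.mem_coe, LinearMap.mem_ker]
    rw [shiftedCoeff_tutteExcess hp hq, if_neg (by omega)]
  exact hle hf

theorem linearIndependent_of_excess_triangular (h0 : T none = uniformTutte n k)
    (hT : ∀ (i : Fin k) (j : Fin m), T (some (i, j)) - uniformTutte n k - tutteExcess (i + 1) (j + 1)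
      ∈ excessSpanBelow (i + 1) (j + 1)) :
    LinearIndependent ℤ T := by
  rw [Fintype.linearIndependent_iff]
  intro g hg
  have hcoeff : ∀ (i j : ℕ) (x : Fin k × Fin m), (x.1 : ℕ) + x.2 ≤ i + j →
      shiftedCoeff (i + 1) (j + 1) (T (some x)) = if (x.1 : ℕ) = i ∧ (x.2 : ℕ) = j then 1 else 0 := by
    rintro i j ⟨a, b⟩ hab
    have h1 := shiftedCoeff_eq_zero_of_mem_excessSpanBelow i.succ_pos j.succ_pos
      (by simp only at hab ⊢; omega) (hT a b)
    rw [map_sub, map_sub, shiftedCoeff_uniformTutte i.succ_pos j.succ_pos,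
      shiftedCoeff_tutteExcess i.succ_pos j.succ_pos] at h1
    simp only [Nat.add_right_cancel_iff, Nat.succ_eq_add_one] at h1 ⊢
    linarith
  -- Induction from the largest total degree downwards: at the leading coefficient of `x`, terms of
  -- larger degree already have coefficient zero, and other terms of no larger degree do not
  -- contribute.
  have hsome : ∀ d : ℕ, ∀ x : Fin k × Fin m, k + m - (x.1 + x.2) = d → g (some x) = 0 := by
    intro d
    induction d using Nat.strong_induction_on with
    | _ d ih =>
    intro x hx
    have h1 := congrArg (shiftedCoeff (x.1 + 1) (x.2 + 1)) hg
    rw [map_sum, map_zero, Finset.sum_eq_single (some x)] at h1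
    · rw [map_smul, hcoeff _ _ x le_rfl] at h1
      simpa using h1
    · rintro (_ | y) - hy
      · rw [map_smul, h0, shiftedCoeff_uniformTutte (Nat.succ_pos _) (Nat.succ_pos _), smul_zero]
      · by_cases hlt : (y.1 : ℕ) + y.2 ≤ x.1 + x.2
        · rw [map_smul, hcoeff _ _ y hlt, if_neg, smul_zero]
          rintro ⟨h2, h3⟩
          exact hy (congrArg some (Prod.ext (Fin.ext h2) (Fin.ext h3)))
        · rw [ih (k + m - (y.1 + y.2)) (by omega) y rfl, zero_smul, map_zero]
    · simp
  rintro (_ | x)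
  · rw [Fintype.sum_option] at hg
    simpa [hsome _ _ rfl, h0, uniformTutte_ne_zero] using hg
  · exact hsome _ x rfl

end Triangular

/-! ### Expansion of an arbitrary Tutte polynomial in excesses. -/

theorem tutte_eq_uniformTutte_add {α : Type*} (M : Matroid α) [M.Finite] {n k : ℕ}
    (hn : M.E.encard = n) (hk : M.eRank = k) :
    M.tutte = uniformTutte n k + ∑ A ∈ M.ground_finite.toFinset.powerset,
      tutteExcess (k - (M.eRk (A : Set α)).toNat) (A.card - (M.eRk (A : Set α)).toNat) := by
  have hcard : M.ground_finite.toFinset.card = n := by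
    rw [M.ground_finite.encard_eq_coe_toFinset_card] at hn
    exact_mod_cast hn
  have hU : uniformTutte n k = ∑ A ∈ M.ground_finite.toFinset.powerset,
      tutteMonomial (k - A.card) (A.card - k) := by
    rw [Finset.sum_powerset_apply_card (fun s => tutteMonomial (k - s) (s - k)), hcard]
    rfl
  rw [hU, ← Finset.sum_add_distrib, tutte]
  refine Finset.sum_congr rfl fun A _ => ?_
  have h1 : (M.eRk (A : Set α)).toNat ≤ k := by
    refine ENat.toNat_le_of_le_natCast ?_
    rw [← hk]
    exact M.eRk_le_eRank _
  have h2 : (M.eRk (A : Set α)).toNat ≤ A.card := by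
    refine ENat.toNat_le_of_le_natCast ?_
    rw [← Set.encard_coe_eq_coe_finsetCard]
    exact M.eRk_le_encard _
  generalize (M.eRk (A : Set α)).toNat = r at h1 h2 ⊢
  rw [tutteExcess, hk, ENat.toNat_natCast, show k - r - (A.card - r) = k - A.card by omega,
    show A.card - r - (k - r) = A.card - k by omega, add_sub_cancel, tutteMonomial]

/-- The nullity of a set is at most the nullity of the ground set. -/
theorem card_sub_eRk_le {α : Type*} (M : Matroid α) [M.Finite] {n k : ℕ}
    (hn : M.E.encard = n) (hk : M.eRank = k) {A : Finset α} (hA : (A : Set α) ⊆ M.E) :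
    A.card - (M.eRk (A : Set α)).toNat ≤ n - k := by
  have h1 : M.eRank ≤ M.eRk A + (M.E \ A).encard := by
    rw [← M.eRk_ground]
    nth_rw 1 [← Set.union_sdiff_cancel hA]
    exact (M.eRk_union_le_eRk_add_eRk _ _).trans (add_le_add_right (M.eRk_le_encard _) _)
  have h2 : (M.E \ A).encard + (A : Set α).encard = M.E.encard := Set.encard_sdiff_add_encard_of_subset hA
  have h3 : M.eRk A ≤ M.eRank := M.eRk_le_eRank _
  rw [hk] at h1 h3
  rw [hn, Set.encard_coe_eq_coe_finsetCard] at h2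
  obtain ⟨r, hr⟩ := ENat.ne_top_iff_exists.1 (ne_top_of_le_ne_top (ENat.natCast_ne_top k) h3)
  obtain ⟨d, hd⟩ := ENat.ne_top_iff_exists.1 (M.ground_finite.sdiff (t := (A : Set α))).encard_lt_top.ne
  rw [← hr, ← hd] at h1
  rw [← hd] at h2
  rw [← hr, ENat.toNat_natCast]
  norm_cast at h1 h2
  omega

/-- Translates uniformity of a contraction into a statement about bases of `M`. -/
theorem IsBasis.contract_isBase_iff_union {α : Type*} {M : Matroid α} {I X B : Set α}
    (hI : M.IsBasis I X) : (M ／ X).IsBase B ↔ M.IsBase (B ∪ I) ∧ Disjoint B X := by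
  simp only [isBase_iff_maximal_indep, Maximal, hI.contract_indep_iff]
  constructor
  · rintro ⟨⟨hBI, hdj⟩, hmax⟩
    refine ⟨⟨hBI, fun J hJ hle x hx => ?_⟩, hdj.symm⟩
    have hIJ : I ⊆ J := Set.subset_union_right.trans hle
    have hJX : J ∩ X = I := (hI.eq_of_subset_indep (hJ.subset Set.inter_subset_left)
      (Set.subset_inter hIJ hI.subset) Set.inter_subset_right).symm
    by_cases hxX : x ∈ X
    · exact Or.inr (hJX ▸ ⟨hx, hxX⟩)
    · refine Or.inl (hmax (y := J \ X) ⟨?_, Set.disjoint_sdiff_right⟩ ?_ ⟨hx, hxX⟩)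
      · exact hJ.subset (Set.union_subset Set.sdiff_subset hIJ)
      · exact Set.subset_sdiff.2 ⟨Set.subset_union_left.trans hle, hdj.symm⟩
  · rintro ⟨⟨hBI, hmax⟩, hdj⟩
    refine ⟨⟨hBI, hdj.symm⟩, fun J hJ hle x hx => ?_⟩
    rcases hmax hJ.1 (Set.union_subset_union_left I hle) (Or.inl hx) with h | h
    · exact h
    · exact absurd hx (Set.disjoint_left.1 hJ.2 (hI.subset h))

/-! ### The model cuspidal matroids. -/

section CuspidalMatroid

variable {α : Type*} [Finite α] {A S I B : Set α} {r k : ℕ}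

/-- The matroid whose independent sets are the sets with at most `k` elements, of which at most
`r` belong to `A`. -/
def cuspidalMatroid (A : Set α) (r k : ℕ) : Matroid α :=
  (IndepMatroid.ofFinite (E := Set.univ) Set.finite_univ
    (fun I => I.ncard ≤ k ∧ (I ∩ A).ncard ≤ r) (by simp)
    (fun I J hJ hIJ => ⟨(Set.ncard_le_ncard hIJ).trans hJ.1,
      (Set.ncard_le_ncard (Set.inter_subset_inter_left A hIJ)).trans hJ.2⟩)
    (by
      rintro I J ⟨hI, hIA⟩ ⟨hJ, hJA⟩ hlt
      -- If `I` has room in `A`, any new element of `J` will do. If `I ∩ A` is full, then `J \ A` is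
      -- larger than `I \ A` and supplies an element outside `A`.
      rcases hIA.lt_or_eq with hIA | hIA
      · obtain ⟨e, heJ, heI⟩ := Set.exists_mem_notMem_of_ncard_lt_ncard hlt
        refine ⟨e, heJ, heI, (Set.ncard_insert_le e I).trans (by omega), ?_⟩
        have h1 : insert e I ∩ A ⊆ insert e (I ∩ A) := by
          rintro x ⟨rfl | hx, hxA⟩
          · exact Or.inl rfl
          · exact Or.inr ⟨hx, hxA⟩
        exact (Set.ncard_le_ncard h1).trans ((Set.ncard_insert_le _ _).trans hIA)
      · have h1 := Set.ncard_inter_add_ncard_sdiff_eq_ncard I A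
        have h2 := Set.ncard_inter_add_ncard_sdiff_eq_ncard J A
        obtain ⟨e, ⟨heJ, heA⟩, heI⟩ :=
          Set.exists_mem_notMem_of_ncard_lt_ncard (show (I \ A).ncard < (J \ A).ncard by omega)
        refine ⟨e, heJ, fun h => heI ⟨h, heA⟩, (Set.ncard_insert_le e I).trans (by omega), ?_⟩
        rw [Set.insert_inter_of_notMem heA]
        exact hIA.le)
    (fun I _ => Set.subset_univ I)).matroid

@[simp] theorem cuspidalMatroid_ground : (cuspidalMatroid A r k).E = Set.univ := rfl

theorem cuspidalMatroid_indep_iff :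
    (cuspidalMatroid A r k).Indep I ↔ I.ncard ≤ k ∧ (I ∩ A).ncard ≤ r := Iff.rfl

theorem cuspidalMatroid_eRk (A S : Set α) (r k : ℕ) :
    (cuspidalMatroid A r k).eRk S = ((min (min S.ncard k) (r + (S \ A).ncard) : ℕ) : ℕ∞) := by
  obtain ⟨I, hI⟩ := (cuspidalMatroid A r k).exists_isBasis' S
  rw [hI.eRk_eq_encard, ← (Set.toFinite I).cast_ncard_eq, Nat.cast_inj]
  obtain ⟨hIk, hIr⟩ := cuspidalMatroid_indep_iff.1 hI.indep
  have h1 := Set.ncard_inter_add_ncard_sdiff_eq_ncard I A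
  have h2 : (I \ A).ncard ≤ (S \ A).ncard :=
    Set.ncard_le_ncard (Set.sdiff_subset_sdiff_left hI.subset)
  have h3 : I.ncard ≤ S.ncard := Set.ncard_le_ncard hI.subset
  refine le_antisymm (by omega) ?_
  by_contra! hlt
  -- A basis `I` of `S` that is too small can only be blocked by the bound on `A`. Then `|I ∩ A| =
  -- r`, so `S \ A` has an element outside `I`, and that element is not blocked.
  have hins : ∀ e ∈ S, e ∉ I → r < (insert e I ∩ A).ncard := by
    intro e he heI
    by_contra! hle
    refine hI.insert_not_indep ⟨he, heI⟩ (cuspidalMatroid_indep_iff.2 ⟨?_, hle⟩)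
    exact (Set.ncard_insert_le e I).trans (by omega)
  obtain ⟨e, he, heI⟩ := Set.exists_mem_notMem_of_ncard_lt_ncard (show I.ncard < S.ncard by omega)
  have h4 : (insert e I ∩ A).ncard ≤ (I ∩ A).ncard + 1 := by
    refine (Set.ncard_le_ncard ?_).trans (Set.ncard_insert_le e (I ∩ A))
    rintro x ⟨rfl | hx, hxA⟩
    · exact Or.inl rfl
    · exact Or.inr ⟨hx, hxA⟩
  have h5 := hins e he heI
  obtain ⟨f, ⟨hf, hfA⟩, hfI⟩ :=
    Set.exists_mem_notMem_of_ncard_lt_ncard (show (I \ A).ncard < (S \ A).ncard by omega)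
  have h6 := hins f hf fun h => hfI ⟨h, hfA⟩
  rw [Set.insert_inter_of_notMem hfA] at h6
  omega

theorem cuspidalMatroid_eRank (hA : k ≤ r + Aᶜ.ncard) (hk : k ≤ Nat.card α) :
    (cuspidalMatroid A r k).eRank = k := by
  rw [← eRk_ground, cuspidalMatroid_eRk, Nat.cast_inj, cuspidalMatroid_ground, Set.ncard_univ,
    ← Set.compl_eq_univ_sdiff]
  omega

theorem cuspidalMatroid_isBase_iff (hA : k ≤ r + Aᶜ.ncard) (hk : k ≤ Nat.card α) :
    (cuspidalMatroid A r k).IsBase B ↔ B.ncard = k ∧ (B ∩ A).ncard ≤ r := by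
  have hrank := cuspidalMatroid_eRank hA hk
  constructor
  · intro h
    refine ⟨?_, (cuspidalMatroid_indep_iff.1 h.indep).2⟩
    have h1 := h.encard_eq_eRank
    rw [hrank, ← (Set.toFinite B).cast_ncard_eq] at h1
    exact_mod_cast h1
  · rintro ⟨h1, h2⟩
    have hI : (cuspidalMatroid A r k).Indep B := cuspidalMatroid_indep_iff.2 ⟨h1.le, h2⟩
    refine hI.isBase_of_eRk_ge (Set.toFinite B) ?_
    rw [hrank, hI.eRk_eq_encard, ← (Set.toFinite B).cast_ncard_eq, h1]

theorem cuspidalMatroid_mapEquiv (e : α ≃ α) :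
    (cuspidalMatroid A r k).mapEquiv e = cuspidalMatroid (e '' A) r k := by
  refine ext_indep (by simp) fun I _ => ?_
  rw [mapEquiv_indep_iff, cuspidalMatroid_indep_iff, cuspidalMatroid_indep_iff,
    Set.ncard_image_of_injective _ e.symm.injective]
  have h : I ∩ e '' A = e '' (e.symm '' I ∩ A) := by
    rw [Set.image_inter e.injective]
    simp
  rw [h, Set.ncard_image_of_injective _ e.injective]

/-- A cyclic flat of `cuspidalMatroid A r k` is the empty set, `A`, or the ground set. -/
theorem cuspidalMatroid_isSchubert (A : Set α) (r k : ℕ) :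
    (cuspidalMatroid A r k).IsSchubert := by
  set M := cuspidalMatroid A r k with hM
  have key : ∀ F, M.IsCyclicFlat F → F = ∅ ∨ F = A ∨ F = Set.univ := by
    rintro F ⟨hF, 𝒞, h𝒞, hFC⟩
    have hrk := cuspidalMatroid_eRk A F r k
    -- Cyclic: deleting an element keeps the rank. Flat (`hnot`): adding one raises it.
    have hmem : ∀ e ∈ F, M.eRk (F \ {e}) = M.eRk F := by
      intro e he
      have he' := he
      rw [hFC] at he'
      obtain ⟨C, hC, heC⟩ := he'
      have hCF : C ⊆ F := hFC ▸ Set.subset_sUnion_of_mem hC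
      have hcl : e ∈ M.closure (F \ {e}) := M.closure_subset_closure
        (Set.sdiff_subset_sdiff_left hCF) ((h𝒞 C hC).mem_closure_sdiff_singleton_of_mem heC)
      rw [← M.eRk_closure_eq, ← closure_insert_eq_of_mem_closure hcl, M.eRk_closure_eq,
        Set.insert_sdiff_singleton, Set.insert_eq_of_mem he]
    have hnot : ∀ e ∉ F, M.eRk (insert e F) = M.eRk F + 1 := by
      intro e he
      refine eRk_insert_eq_add_one ⟨Set.mem_univ e, ?_⟩
      rwa [hF.closure]
    by_cases hne : F = ∅
    · exact Or.inl hne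
    by_cases hun : F = Set.univ
    · exact Or.inr (Or.inr hun)
    refine Or.inr (Or.inl ?_)
    obtain ⟨e, he⟩ := Set.nonempty_iff_ne_empty.2 hne
    obtain ⟨f, hf⟩ := (Set.ne_univ_iff_exists_notMem F).1 hun
    have h1 := hmem e he
    have h2 := hnot f hf
    simp only [hM, cuspidalMatroid_eRk] at hmem hnot h1 h2
    norm_cast at hmem hnot h1 h2
    have h3 := Set.ncard_sdiff_singleton_add_one he
    -- Now `rk F` is less than both `k` and `|F|`, so `rk F = r + |F \ A|`. Deleting a point of `F \
    -- A` would lower this, and adding a point of `A \ F` would not raise it.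
    refine Set.Subset.antisymm (fun x hx => ?_) (fun x hx => ?_)
    · by_contra hxA
      have h4 := hmem x hx
      have h5 := Set.ncard_sdiff_singleton_add_one (show x ∈ F \ A from ⟨hx, hxA⟩)
      rw [sdiff_right_comm] at h4
      omega
    · by_contra hxF
      have h4 := hnot x hxF
      rw [Set.insert_sdiff_of_mem _ hx] at h4
      omega
  intro F hF G hG hne
  rcases key F hF with rfl | rfl | rfl <;> rcases key G hG with rfl | rfl | rfl <;> simp at *

theorem cuspidalMatroid_isStressed (hA : k ≤ r + Aᶜ.ncard) (hrA : r ≤ A.ncard) (hrk : r ≤ k) :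
    (cuspidalMatroid A r k).IsStressed A := by
  have hcard := Set.ncard_add_ncard_compl A
  have hk : k ≤ Nat.card α := by omega
  have hrkA : (cuspidalMatroid A r k).eRk A = r := by
    rw [cuspidalMatroid_eRk, Set.sdiff_self, Set.ncard_empty, Nat.cast_inj]
    omega
  have hbasis : ∀ B ⊆ A, B.ncard = r → (cuspidalMatroid A r k).IsBasis B A := by
    intro B hBA hB
    have hI : (cuspidalMatroid A r k).Indep B := by
      rw [cuspidalMatroid_indep_iff, Set.inter_eq_left.2 hBA]
      omega
    refine hI.isBasis_of_eRk_ge (Set.toFinite B) hBA ?_ (Set.subset_univ A)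
    rw [hrkA, hI.eRk_eq_encard, ← (Set.toFinite B).cast_ncard_eq, hB]
  refine ⟨Set.subset_univ A, fun B hBA hB => ?_, fun B hBE hB => ?_⟩
  · rw [isBase_restrict_iff]
    refine hbasis B hBA ?_
    rw [eRank_restrict, hrkA, ← (Set.toFinite B).cast_ncard_eq] at hB
    exact_mod_cast hB
  · obtain ⟨I, hIA, hI⟩ := Set.exists_subset_card_eq hrA
    have hdisj : Disjoint B A := (Set.subset_sdiff.1 hBE).2
    -- `B'` serves only to compute the rank of the contraction.
    obtain ⟨B', hB'⟩ := ((cuspidalMatroid A r k) ／ A).exists_isBase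
    have hcon := (hbasis I hIA hI).contract_isBase_iff_union (B := B')
    rw [← hB'.encard_eq_eRank] at hB
    rw [hcon, cuspidalMatroid_isBase_iff hA hk] at hB'
    rw [(hbasis I hIA hI).contract_isBase_iff_union, cuspidalMatroid_isBase_iff hA hk]
    have hBB' : B.ncard = B'.ncard := congrArg ENat.toNat hB
    have h1 := Set.ncard_union_eq (hB'.2.mono_right hIA)
    have h2 := Set.ncard_union_eq (hdisj.mono_right hIA)
    refine ⟨⟨by omega, ?_⟩, hdisj⟩
    rw [Set.union_inter_distrib_right, hdisj.inter_eq, Set.empty_union, Set.inter_eq_left.2 hIA, hI]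

/-- The cusp of `A` alone contains every `k`-subset that is not a basis. -/
theorem cuspidalMatroid_isElementarySplit (hA : k ≤ r + Aᶜ.ncard) (hrA : r ≤ A.ncard)
    (hrk : r ≤ k) : (cuspidalMatroid A r k).IsElementarySplit := by
  have hcard := Set.ncard_add_ncard_compl A
  have hk : k ≤ Nat.card α := by omega
  have hrkA : (cuspidalMatroid A r k).eRk A = r := by
    rw [cuspidalMatroid_eRk, Set.sdiff_self, Set.ncard_empty, Nat.cast_inj]
    omega
  refine Set.Subset.antisymm ?_ fun S hS => ?_
  · rintro S (hS | hS)
    · exact ⟨hS.subset_ground, hS.encard_eq_eRank⟩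
    · simp only [Set.mem_iUnion] at hS
      obtain ⟨D, -, hS⟩ := hS
      exact ⟨hS.1, hS.2.1⟩
  · have hSk : S.ncard = k := by
      have h := hS.2
      rw [cuspidalMatroid_eRank hA hk, ← (Set.toFinite S).cast_ncard_eq] at h
      exact_mod_cast h
    by_cases hle : (S ∩ A).ncard ≤ r
    · exact Or.inl ((cuspidalMatroid_isBase_iff hA hk).2 ⟨hSk, hle⟩)
    · have hcusp : S ∈ (cuspidalMatroid A r k).cusp A := by
        refine ⟨hS.1, hS.2, ?_⟩
        rw [hrkA, ← (Set.toFinite (S ∩ A)).cast_ncard_eq]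
        exact_mod_cast not_le.1 hle
      exact Or.inr (Set.mem_biUnion
        (show A ∈ {A | _ ∧ _} from ⟨cuspidalMatroid_isStressed hA hrA hrk, S, hcusp⟩) hcusp)

theorem cuspidalMatroid_isCuspidal (hA : k ≤ r + Aᶜ.ncard) (hrA : r ≤ A.ncard) (hrk : r ≤ k) :
    (cuspidalMatroid A r k).IsCuspidal :=
  ⟨cuspidalMatroid_isSchubert A r k, cuspidalMatroid_isElementarySplit hA hrA hrk⟩

end CuspidalMatroid

/-! ### Tutte polynomials of the models. -/

section Tutte

variable {α : Type*} [Finite α] {A : Set α} {r k : ℕ}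

theorem cuspidalMatroid_tutte (hA : k ≤ r + Aᶜ.ncard) (hk : k ≤ Nat.card α) :
    (cuspidalMatroid A r k).tutte = uniformTutte (Nat.card α) k +
      ∑ S ∈ (cuspidalMatroid A r k).ground_finite.toFinset.powerset,
        tutteExcess (k - r - ((S : Set α) \ A).ncard) (((S : Set α) ∩ A).ncard - r) := by
  rw [tutte_eq_uniformTutte_add _ (n := Nat.card α) 
    (by rw [cuspidalMatroid_ground, ← Set.finite_univ.cast_ncard_eq, Set.ncard_univ])
    (cuspidalMatroid_eRank hA hk)]
  congr 1
  refine Finset.sum_congr rfl fun S _ => ?_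
  have h1 := Set.ncard_inter_add_ncard_sdiff_eq_ncard (S : Set α) A
  rw [cuspidalMatroid_eRk, ENat.toNat_natCast, ← Set.ncard_coe_finset]
  -- Both excesses vanish unless `|S ∩ A| > r` and `|S \ A| < k - r`; in that case `S` has rank `r +
  -- |S \ A|`.
  rcases le_or_gt ((S : Set α) ∩ A).ncard r with h2 | h2
  · rw [Nat.sub_eq_zero_of_le h2, tutteExcess_zero_right]
    rcases le_or_gt k (S : Set α).ncard with h3 | h3
    · rw [show k - min (min (S : Set α).ncard k) (r + ((S : Set α) \ A).ncard) = 0 by omega,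
        tutteExcess_zero_left]
    · rw [show (S : Set α).ncard - min (min (S : Set α).ncard k) (r + ((S : Set α) \ A).ncard) = 0
        by omega, tutteExcess_zero_right]
  · rcases le_or_gt (k - r) ((S : Set α) \ A).ncard with h3 | h3
    · rw [Nat.sub_eq_zero_of_le h3,
        show k - min (min (S : Set α).ncard k) (r + ((S : Set α) \ A).ncard) = 0 by omega,
        tutteExcess_zero_left, tutteExcess_zero_left]
    · congr 1 <;> omega

theorem cuspidalMatroid_empty_tutte (hk : k ≤ Nat.card α) :
    (cuspidalMatroid (∅ : Set α) 0 k).tutte = uniformTutte (Nat.card α) k := by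
  rw [cuspidalMatroid_tutte (by simpa) hk]
  simp

/-- The leading excess comes from `S = A`; equality of both exponents forces `S ⊆ A` and `|S ∩ A| =
|A|`, so it occurs once. -/
theorem cuspidalMatroid_tutte_sub_mem (hA : k ≤ r + Aᶜ.ncard) (hrA : r < A.ncard) (hrk : r < k) :
    (cuspidalMatroid A r k).tutte - uniformTutte (Nat.card α) k - tutteExcess (k - r) (A.ncard - r)
      ∈ excessSpanBelow (k - r) (A.ncard - r) := by
  classical
  have hcard := Set.ncard_add_ncard_compl A
  rw [cuspidalMatroid_tutte hA (by omega), add_sub_cancel_left,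
    ← Finset.add_sum_erase _ _ (a := (Set.toFinite A).toFinset)]
  · rw [Set.Finite.coe_toFinset, Set.sdiff_self, Set.ncard_empty, Set.inter_self, Nat.sub_zero,
      add_sub_cancel_left]
    refine sum_mem fun S hS => Submodule.subset_span ?_
    refine ⟨_, _, Nat.sub_le _ _, Nat.sub_le_sub_right
      (Set.ncard_le_ncard Set.inter_subset_right) r, ?_, rfl⟩
    have hne := Finset.ne_of_mem_erase hS
    have h1 : ((S : Set α) ∩ A).ncard ≤ A.ncard := Set.ncard_le_ncard Set.inter_subset_right
    by_contra hlt
    refine hne (Finset.coe_injective ?_)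
    rw [Set.Finite.coe_toFinset]
    have h2 : ((S : Set α) \ A).ncard = 0 := by omega
    rw [Set.ncard_eq_zero, Set.sdiff_eq_empty] at h2
    refine Set.eq_of_subset_of_ncard_le h2 ?_
    rw [Set.inter_eq_left.2 h2] at hlt h1
    omega
  · simp [← Finset.coe_subset]

end Tutte

/-! ### Stressed subsets with non-empty cusp. -/

section Stressed

variable {α : Type*} {M : Matroid α} {A B : Set α}

theorem encard_insert_sdiff_singleton_eq {B : Set α} {e f : α} (he : e ∈ B) (hf : f ∉ B) :
    (insert f (B \ {e})).encard = B.encard := by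
  rw [Set.encard_insert_of_notMem (fun h => hf h.1), Set.encard_sdiff_singleton_add_one he]

theorem eRk_lt_encard_of_cusp_nonempty [M.Finite] (h : (M.cusp A).Nonempty) :
    M.eRk A < A.encard := by
  obtain ⟨S, -, -, hSA⟩ := h
  exact (ENat.add_one_le_iff (M.isRkFinite_set A).eRk_lt_top.ne).1
    (hSA.trans (Set.encard_le_encard Set.inter_subset_right))

theorem eRk_lt_eRank_of_cusp_nonempty [M.Finite] (h : (M.cusp A).Nonempty) :
    M.eRk A < M.eRank := by
  obtain ⟨S, -, hS, hSA⟩ := h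
  rw [← hS]
  exact (ENat.add_one_le_iff (M.isRkFinite_set A).eRk_lt_top.ne).1
    (hSA.trans (Set.encard_le_encard Set.inter_subset_left))

/-- A point of the closure outside `A` is a loop of `M ／ A`. Uniformity and positive rank would let
it be exchanged into a base. -/
theorem IsStressed.isFlat (hA : M.IsStressed A) (hlt : M.eRk A < M.eRank) : M.IsFlat A := by
  obtain ⟨hAE, -, hcon⟩ := hA
  rw [isFlat_iff_closure_eq]
  refine Set.Subset.antisymm (fun e he => ?_) (M.subset_closure A)
  by_contra heA
  have hloop : (M ／ A).IsLoop e := contract_isLoop_iff_mem_closure.2 ⟨he, heA⟩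
  obtain ⟨I, hI⟩ := M.exists_isBasis A
  obtain ⟨B, hB⟩ := (M ／ A).exists_isBase
  obtain rfl | ⟨f, hf⟩ := B.eq_empty_or_nonempty
  · rw [hI.contract_isBase_iff_union, Set.empty_union] at hB
    rw [← hI.encard_eq_eRk, hB.1.encard_eq_eRank] at hlt
    exact hlt.false
  have heB : e ∉ B := fun h => hloop.not_isNonloop (hB.indep.isNonloop_of_mem h)
  have hB' := hcon (insert e (B \ {f}))
    (Set.insert_subset hloop.mem_ground (Set.sdiff_subset.trans hB.subset_ground))
    (by rw [encard_insert_sdiff_singleton_eq hf heB, hB.encard_eq_eRank])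
  exact hloop.not_isNonloop (hB'.indep.isNonloop_of_mem (Set.mem_insert e _))

/-- In the uniform restriction an exchange yields a basis of `A` that avoids `x`; the fundamental
circuit of `x` does the rest. -/
theorem IsStressed.exists_isCircuit (hA : M.IsStressed A) (hlt : M.eRk A < A.encard) {x : α}
    (hx : x ∈ A) : ∃ C, M.IsCircuit C ∧ C ⊆ A ∧ x ∈ C := by
  obtain ⟨hAE, hres, -⟩ := hA
  have key : ∃ I, M.IsBasis I A ∧ x ∉ I := by
    obtain ⟨I, hI⟩ := M.exists_isBasis A
    by_cases hxI : x ∈ I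
    · obtain ⟨y, hyA, hyI⟩ : ∃ y ∈ A, y ∉ I := by
        by_contra! hAI
        rw [← hI.encard_eq_eRk] at hlt
        exact (Set.encard_le_encard hAI).not_gt hlt
      have h := hres (insert y (I \ {x}))
        (Set.insert_subset hyA (Set.sdiff_subset.trans hI.subset))
        (by rw [encard_insert_sdiff_singleton_eq hxI hyI, eRank_restrict, hI.encard_eq_eRk])
      rw [isBase_restrict_iff] at h
      refine ⟨_, h, ?_⟩
      rintro (rfl | h)
      · exact hyI hxI
      · exact h.2 rfl
    · exact ⟨I, hI, hxI⟩
  obtain ⟨I, hI, hxI⟩ := key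
  exact ⟨M.fundCircuit x I, hI.indep.fundCircuit_isCircuit (hI.subset_closure hx) hxI,
    (M.fundCircuit_subset_insert x I).trans (Set.insert_subset hx hI.subset),
    M.mem_fundCircuit x I⟩

theorem IsStressed.isCyclicFlat (hA : M.IsStressed A) (h1 : M.eRk A < M.eRank)
    (h2 : M.eRk A < A.encard) : M.IsCyclicFlat A := by
  refine ⟨hA.isFlat h1, {C | M.IsCircuit C ∧ C ⊆ A}, fun C hC => hC.1, ?_⟩
  refine Set.Subset.antisymm (fun x hx => ?_) (Set.sUnion_subset fun C hC => hC.2)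
  obtain ⟨C, hC, hCA, hxC⟩ := hA.exists_isCircuit h2 hx
  exact ⟨C, ⟨hC, hCA⟩, hxC⟩

/-- A dependent flat inside a set `B` with `M ↾ B` uniform is equal to `B`. -/
theorem IsFlat.eq_of_subset_of_isUniform (hA : M.IsFlat A) (h2 : M.eRk A < A.encard)
    (hB : (M ↾ B).IsUniform) (hBE : B ⊆ M.E) (hAB : A ⊆ B) : A = B := by
  -- By uniformity, either `A` contains a basis of `B`, whence `B ⊆ cl A = A`, or `A` extends to one
  -- and is independent, contrary to `h2`.
  rcases le_total (M.eRk B) A.encard with hle | hle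
  · obtain ⟨I, hIA, hI⟩ := Set.exists_subset_encard_eq hle
    have hbase := hB I (hIA.trans hAB) (by rw [hI, eRank_restrict])
    rw [isBase_restrict_iff] at hbase
    refine hAB.antisymm (hbase.subset_closure.trans ?_)
    exact (M.closure_subset_closure hIA).trans hA.closure.subset
  · obtain ⟨I, hAI, hIB, hI⟩ := Set.exists_superset_subset_encard_eq hAB hle (M.eRk_le_encard B)
    have hbase := hB I hIB (by rw [hI, eRank_restrict])
    rw [isBase_restrict_iff] at hbase
    rw [(hbase.indep.subset hAI).eRk_eq_encard] at h2
    exact absurd h2 (lt_irrefl _)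

/-- Both sets are cyclic flats, hence comparable, and the smaller is a dependent flat in a uniform
restriction. -/
theorem IsSchubert.eq_of_isStressed [M.Finite] (hM : M.IsSchubert) (hA : M.IsStressed A)
    (hA' : (M.cusp A).Nonempty) (hB : M.IsStressed B) (hB' : (M.cusp B).Nonempty) : A = B := by
  have hA1 := eRk_lt_eRank_of_cusp_nonempty hA'
  have hA2 := eRk_lt_encard_of_cusp_nonempty hA'
  have hB1 := eRk_lt_eRank_of_cusp_nonempty hB'
  have hB2 := eRk_lt_encard_of_cusp_nonempty hB'
  rcases hM.total (hA.isCyclicFlat hA1 hA2) (hB.isCyclicFlat hB1 hB2) with h | h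
  · exact (hA.isFlat hA1).eq_of_subset_of_isUniform hA2 hB.2.1 hB.1 h
  · exact ((hB.isFlat hB1).eq_of_subset_of_isUniform hB2 hA.2.1 hA.1 h).symm

end Stressed

/-! ### Classification of cuspidal matroids. -/

section Classification

variable {α : Type*} [Finite α] {M : Matroid α} {k : ℕ}

theorem IsUniform.eq_cuspidalMatroid (hM : M.IsUniform) (hE : M.E = Set.univ)
    (hk : M.eRank = k) : M = cuspidalMatroid ∅ 0 k := by
  have hkn : k ≤ Nat.card α := by
    have h := M.eRank_le_encard_ground
    rw [hk, hE, ← Set.finite_univ.cast_ncard_eq, Set.ncard_univ] at h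
    exact_mod_cast h
  refine ext_isBase (by simp [hE]) fun B hB => ?_
  rw [cuspidalMatroid_isBase_iff (by simpa) hkn]
  have hcard : B.ncard = k ↔ B.encard = M.eRank := by
    rw [hk, ← (Set.toFinite B).cast_ncard_eq, Nat.cast_inj]
  simp only [Set.inter_empty, Set.ncard_empty, le_refl, and_true, hcard]
  exact ⟨fun h => h.encard_eq_eRank, hM B hB⟩

/-- One `k`-set that is not a basis yields a stressed `A`. By uniqueness all such sets lie in the
cusp of this `A`, which determines the bases. -/
theorem IsCuspidal.eq_cuspidalMatroid (hM : M.IsCuspidal) (hE : M.E = Set.univ)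
    (hk : M.eRank = k) : M = cuspidalMatroid ∅ 0 k ∨ ∃ (A : Set α) (r : ℕ),
      r < k ∧ r < A.ncard ∧ k ≤ r + Aᶜ.ncard ∧ M = cuspidalMatroid A r k := by
  by_cases hunif : M.IsUniform
  · exact Or.inl (hunif.eq_cuspidalMatroid hE hk)
  right
  obtain ⟨hS, hsplit⟩ := hM
  have hsplit' : ∀ S ⊆ M.E, S.encard = M.eRank → ¬ M.IsBase S →
      ∃ A, M.IsStressed A ∧ S ∈ M.cusp A := by
    intro S hSE hSk hSB
    have h : S ∈ M.relaxedBases := by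
      rw [hsplit]
      exact ⟨hSE, hSk⟩
    rcases h with h | h
    · exact absurd h hSB
    · simp only [Set.mem_iUnion] at h
      obtain ⟨A, hA, hSA⟩ := h
      exact ⟨A, hA.1, hSA⟩
  simp only [IsUniform, not_forall] at hunif
  obtain ⟨S, hSE, hSk, hSB⟩ := hunif
  obtain ⟨A, hA, hSA⟩ := hsplit' S hSE hSk hSB
  have h1 := eRk_lt_eRank_of_cusp_nonempty ⟨S, hSA⟩
  have h2 := eRk_lt_encard_of_cusp_nonempty ⟨S, hSA⟩
  obtain ⟨r, hr⟩ := ENat.ne_top_iff_exists.1 h1.ne_top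
  rw [hk, ← hr] at h1
  rw [← hr, ← (Set.toFinite A).cast_ncard_eq] at h2
  norm_cast at h1 h2
  have hcompl : k ≤ r + Aᶜ.ncard := by
    have h := M.eRk_union_le_eRk_add_eRk A Aᶜ
    rw [Set.union_compl_self, ← hE, eRk_ground, hk, ← hr] at h
    have h' := h.trans (add_le_add_right (M.eRk_le_encard Aᶜ) _)
    rw [← (Set.toFinite Aᶜ).cast_ncard_eq] at h'
    exact_mod_cast h'
  have hcard := Set.ncard_add_ncard_compl A
  refine ⟨A, r, h1, h2, hcompl, ext_isBase (by simp [hE]) fun B hB => ?_⟩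
  rw [cuspidalMatroid_isBase_iff hcompl (by omega)]
  have hBk : B.ncard = k ↔ B.encard = M.eRank := by
    rw [hk, ← (Set.toFinite B).cast_ncard_eq, Nat.cast_inj]
  have hBr : (B ∩ A).ncard ≤ r ↔ (B ∩ A).encard ≤ M.eRk A := by
    rw [← hr, ← (Set.toFinite (B ∩ A)).cast_ncard_eq, Nat.cast_le]
  rw [hBk, hBr]
  constructor
  · intro h
    exact ⟨h.encard_eq_eRank, (h.indep.subset Set.inter_subset_left).encard_le_eRk_of_subset
      Set.inter_subset_right⟩
  · rintro ⟨h3, h4⟩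
    by_contra hBB
    obtain ⟨D, hD, hBD⟩ := hsplit' B hB h3 hBB
    obtain rfl := hS.eq_of_isStressed hA ⟨S, hSA⟩ hD ⟨B, hBD⟩
    have h5 := hBD.2.2
    rw [← hr] at h4 h5
    exact absurd (h5.trans h4) (by norm_cast; omega)

end Classification

/-! ### Isomorphism classes and the basis of Tutte polynomials. -/

theorem _root_.Set.exists_perm_image_eq {α : Type*} [Finite α] {A B : Set α}
    (h : A.ncard = B.ncard) : ∃ e : Equiv.Perm α, e '' A = B := by
  classical
  have := Fintype.ofFinite α
  obtain ⟨f⟩ : Nonempty ({x // x ∈ A} ≃ {x // x ∈ B}) := Finite.card_eq.1 h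
  refine ⟨f.extendSubtype, Set.eq_of_subset_of_ncard_le ?_ ?_⟩
  · rintro _ ⟨x, hx, rfl⟩
    exact f.extendSubtype_mem x hx
  · rw [Set.ncard_image_of_injective _ f.extendSubtype.injective, h]

/-- The initial segment with `h` elements of `Fin n`. -/
def initialSegment (n h : ℕ) : Set (Fin n) := {x | (x : ℕ) < h}

theorem initialSegment_ncard {n h : ℕ} (hn : h ≤ n) : (initialSegment n h).ncard = h := by
  have : initialSegment n h = Set.range (Fin.castLE hn) := by
    ext x
    simp [initialSegment, Fin.range_castLE]
  rw [this, ← Set.image_univ, Set.ncard_image_of_injective _ (Fin.castLE_injective hn),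
    Set.ncard_univ, Nat.card_eq_fintype_card, Fintype.card_fin]

section Representatives

variable {n k : ℕ}

theorem initialSegment_bounds {r h : ℕ} (hh : h ≤ n) (hr : k + h ≤ n + r) :
    k ≤ r + (initialSegment n h)ᶜ.ncard := by
  have h1 := Set.ncard_add_ncard_compl (initialSegment n h)
  rw [initialSegment_ncard hh, Nat.card_eq_fintype_card, Fintype.card_fin] at h1
  omega

/-- The representatives of the isomorphism classes of cuspidal matroids of rank `k` on `n`
elements: the uniform matroid, and for `1 ≤ s ≤ k` and `1 ≤ t ≤ n - k` the matroid whose stressed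
subset with non-empty cusp has rank `k - s` and `k - s + t` elements. -/
def cuspidalRep (hk : k ≤ n) : Option (Fin k × Fin (n - k)) → CuspidalOn n k
  | none => ⟨cuspidalMatroid ∅ 0 k, rfl, cuspidalMatroid_eRank (by simpa) (by simpa),
      cuspidalMatroid_isCuspidal (by simpa) (Nat.zero_le _) (Nat.zero_le _)⟩
  | some (i, j) =>
    have hi := i.isLt
    have hj := j.isLt
    have hh : k - (i + 1) + (j + 1) ≤ n := by omega
    ⟨cuspidalMatroid (initialSegment n (k - (i + 1) + (j + 1))) (k - (i + 1)) k, rfl,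
      cuspidalMatroid_eRank (initialSegment_bounds hh (by omega)) (by simpa),
      cuspidalMatroid_isCuspidal (initialSegment_bounds hh (by omega))
        (by rw [initialSegment_ncard hh]; omega) (Nat.sub_le _ _)⟩

/-- The isomorphism class of a representative. -/
def cuspidalClassRep (hk : k ≤ n) (x : Option (Fin k × Fin (n - k))) : CuspidalClass n k :=
  Quotient.mk _ (cuspidalRep hk x)

theorem cuspidalClassRep_surjective (hk : k ≤ n) : Function.Surjective (cuspidalClassRep hk) := by
  intro q
  induction q using Quotient.inductionOn with
  | _ M =>
  obtain ⟨M, hE, hrank, hM⟩ := M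
  rcases hM.eq_cuspidalMatroid hE hrank with rfl | ⟨A, r, hrk, hrA, hA, rfl⟩
  · exact ⟨none, rfl⟩
  · have hcard := Set.ncard_add_ncard_compl A
    rw [Nat.card_eq_fintype_card, Fintype.card_fin] at hcard
    -- The indices are `s - 1` and `t - 1` for `s = k - r`, `t = |A| - r`.
    refine ⟨some (⟨k - r - 1, by omega⟩, ⟨A.ncard - r - 1, by omega⟩), Quotient.sound ?_⟩
    have h1 : k - (k - r - 1 + 1) = r := by omega
    have h2 : r + (A.ncard - r - 1 + 1) = A.ncard := by omega
    obtain ⟨e, he⟩ := Set.exists_perm_image_eq (A := initialSegment n A.ncard) (B := A)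
      (initialSegment_ncard (by omega))
    refine ⟨e, ?_⟩
    simp only [cuspidalRep, h1, h2, cuspidalMatroid_mapEquiv, he]

theorem cuspidalClassRep_none_tutte (hk : k ≤ n) :
    (cuspidalClassRep hk none).tutte = uniformTutte n k := by
  have h := cuspidalMatroid_empty_tutte (α := Fin n) (k := k) (by simpa)
  rwa [Nat.card_eq_fintype_card, Fintype.card_fin] at h

theorem cuspidalClassRep_some_tutte_mem (hk : k ≤ n) (i : Fin k) (j : Fin (n - k)) :
    (cuspidalClassRep hk (some (i, j))).tutte - uniformTutte n k - tutteExcess (i + 1) (j + 1)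
      ∈ excessSpanBelow (i + 1) (j + 1) := by
  have hh : k - (i + 1) + (j + 1) ≤ n := by omega
  have h := cuspidalMatroid_tutte_sub_mem (A := initialSegment n (k - (i + 1) + (j + 1)))
    (initialSegment_bounds hh (by omega)) (by rw [initialSegment_ncard hh]; omega)
    (show k - (i + 1) < k by omega)
  rw [Nat.card_eq_fintype_card, Fintype.card_fin, initialSegment_ncard hh,
    show k - (k - ((i : ℕ) + 1)) = i + 1 by omega, Nat.add_sub_cancel_left] at h
  exact h

theorem linearIndependent_tutte_cuspidalClassRep (hk : k ≤ n) :
    LinearIndependent ℤ fun x => (cuspidalClassRep hk x).tutte :=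
  linearIndependent_of_excess_triangular (cuspidalClassRep_none_tutte hk)
    (cuspidalClassRep_some_tutte_mem hk)

/-- The isomorphism classes of cuspidal matroids are in bijection with their representatives. -/
noncomputable def cuspidalClassEquiv (hk : k ≤ n) :
    Option (Fin k × Fin (n - k)) ≃ CuspidalClass n k :=
  Equiv.ofBijective (cuspidalClassRep hk)
    -- A linearly independent family is injective, so the Tutte polynomial already separates the
    -- classes.
    ⟨fun _ _ h => (linearIndependent_tutte_cuspidalClassRep hk).injective
      (congrArg CuspidalClass.tutte h), cuspidalClassRep_surjective hk⟩

theorem linearIndependent_tutte_cuspidalClass (hk : k ≤ n) :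
    LinearIndependent ℤ (CuspidalClass.tutte (n := n) (k := k)) :=
  (linearIndependent_equiv' (cuspidalClassEquiv hk) rfl).1
    (linearIndependent_tutte_cuspidalClassRep hk)

theorem tutte_mem_span_range_cuspidalClass {α : Type*} (M : Matroid α) [M.Finite]
    (hn : M.E.encard = n) (hk : M.eRank = k) :
    M.tutte ∈ Submodule.span ℤ (Set.range (CuspidalClass.tutte (n := n) (k := k))) := by
  have hkn : k ≤ n := by
    have h := M.eRank_le_encard_ground
    rw [hn, hk] at h
    exact_mod_cast h
  have hle : Submodule.span ℤ (Set.range fun x => (cuspidalClassRep hkn x).tutte) ≤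
      Submodule.span ℤ (Set.range (CuspidalClass.tutte (n := n) (k := k))) :=
    Submodule.span_mono (Set.range_comp_subset_range (cuspidalClassRep hkn) CuspidalClass.tutte)
  have h0 : uniformTutte n k ∈
      Submodule.span ℤ (Set.range fun x => (cuspidalClassRep hkn x).tutte) :=
    Submodule.subset_span ⟨none, cuspidalClassRep_none_tutte hkn⟩
  refine hle ?_
  rw [tutte_eq_uniformTutte_add M hn hk]
  refine add_mem h0 (sum_mem fun A hA => ?_)
  rw [Finset.mem_powerset, ← Finset.coe_subset, Set.Finite.coe_toFinset] at hA
  exact tutteExcess_mem_span_range (T := fun x => (cuspidalClassRep hkn x).tutte)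
    (cuspidalClassRep_none_tutte hkn)
    (cuspidalClassRep_some_tutte_mem hkn) (Nat.sub_le _ _) (card_sub_eRk_le M hn hk hA)

end Representatives

end Matroid

theorem theoremC (n k : ℕ) (hk : k ≤ n) :
    Nat.card (Matroid.CuspidalClass n k) = k * (n - k) + 1 ∧
    ∀ {α : Type*} (M : Matroid α) [M.Finite], M.E.encard = n → M.eRank = k →
      ∃! c : Matroid.CuspidalClass n k →₀ ℤ, M.tutte = c.sum fun q a => a • q.tutte := by
  refine ⟨?_, fun M _ hn hr => ?_⟩
  · rw [← Nat.card_congr (Matroid.cuspidalClassEquiv hk)]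
    simp
  · obtain ⟨c, hc⟩ := Finsupp.mem_span_range_iff_exists_finsupp.1
      (Matroid.tutte_mem_span_range_cuspidalClass M hn hr)
    refine ⟨c, hc.symm, fun d hd => ?_⟩
    refine Matroid.linearIndependent_tutte_cuspidalClass hk ?_
    rw [Finsupp.linearCombination_apply, Finsupp.linearCombination_apply, hc]
    exact hd.symm
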